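/- For an entire function $f:\mathbb{C}\to\mathbb{C}$, let its order $\alpha(f)\in[0,\infty]$ be the infimum of all real $\alpha\ge 0$ such that $\log\max_{|z|\le r}|f(z)|\le O(r^\alpha)$ as $r\to\infty$ (and $+\infty$ if there is no such $\alpha$). For a real number $\rho\ge 0$ let $\mathscr{H}^\rho$ be the ring of entire functions $f$ with $\alpha(f)\le\rho$. Consider the Pell equation $$X^2-(z^2-1)Y^2=1. \qquad (*)$$ The pairs of entire functions solving $(*)$ form an abelian group under $(u,v)\oplus(x,y)=(ux+(z^2-1)vy,\ uy+vx)$; write $(x,y)^{\oplus k}$ for the $k$-th multiple of $(x,y)$ in this group. For $n\in\mathbb{Z}$ define polynomials $x_n,y_n\in\mathbb{C}[z]$ by $x_n+y_nw=(z+w)^n$, where $w=\sqrt{z^2-1}$. Let $\rho\ge 0$ be a real number, let $m=2(\lfloor\rho\rfloor+1)$, let $p,q$ be primes with $p>m+1$ and $q>2(m+1)$, and let $k=pq$. Let $(x,y)$ be a solution of $(*)$ with $x,y\in\mathscr{H}^\rho$ such that (i) there is a solution $(s,t)$ of $(*)$ with $s,t\in\mathscr{H}^\rho$ and $(s,t)^{\oplus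 k}=(x,y)$; and (ii) the polynomial $y_k$ divides $y$ in $\mathscr{H}^\rho$. Then $y=y_{kn}$ for some integer $n$. Conversely, for every integer $\ell$, the pair $(x,y)=(x_{k\ell},y_{k\ell})$ is a solution of $(*)$ with $x,y\in\mathscr{H}^\rho$, and it satisfies (i) and (ii). -/

import Mathlib

open Polynomial Filter
open scoped ENNReal NNReal

noncomputable section

/-- The ring of entire functions of one complex variable, with pointwise operations. -/
def Entire : Subring (ℂ → ℂ) where
  carrier := {f | Differentiable ℂ f}
  mul_mem' hf hg := Differentiable.mul hf hg
  one_mem' := differentiable_const 1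
  add_mem' hf hg := Differentiable.add hf hg
  zero_mem' := differentiable_const 0
  neg_mem' hf := Differentiable.neg hf

/-- A complex polynomial regarded as an entire function. -/
def polyEntire (P : ℂ[X]) : Entire := ⟨fun z => P.eval z, P.differentiable⟩

/-- The coordinate function `z`. -/
def coordZ : Entire := polyEntire X

/-- `max_{|z| ≤ r} |f(z)|`. -/
def maxModulus (f : Entire) (r : ℝ) : ℝ :=
  sSup ((fun z : ℂ => ‖f.1 z‖) '' Metric.closedBall 0 r)

/-- The order of an entire function: the infimum of the real `α ≥ 0` with
`log max_{|z| ≤ r} |f(z)| ≤ O(r ^ α)` as `r → ∞`; it is `∞` if there is no such `α`. -/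
def growthOrder (f : Entire) : ℝ≥0∞ :=
  ⨅ (α : ℝ≥0) (_ : ∃ C : ℝ, ∀ᶠ r : ℝ in atTop,
    Real.log (maxModulus f r) ≤ C * r ^ (α : ℝ)), (α : ℝ≥0∞)

/-- The entire functions of order at most `ρ` (used for `ρ ≥ 0`). -/
def boundedOrder (ρ : ℝ) : Set Entire := {f | growthOrder f ≤ ENNReal.ofReal ρ}

/-- `f` divides `g` in the ring of entire functions of order at most `ρ`. -/
def DvdBoundedOrder (ρ : ℝ) (f g : Entire) : Prop :=
  f ∈ boundedOrder ρ ∧ g ∈ boundedOrder ρ ∧ ∃ h ∈ boundedOrder ρ, g = f * h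

/-- The element `z + w` of `ℂ[z][w]`, `w ^ 2 = z ^ 2 - 1`, as a unit with inverse `z - w`. -/
def zAddW : (QuadraticAlgebra ℂ[X] (X ^ 2 - 1) 0)ˣ where
  val := ⟨X, 1⟩
  inv := ⟨X, -1⟩
  val_inv := by
    ext1 <;> simp [QuadraticAlgebra.re_one, QuadraticAlgebra.im_one]; ring
  inv_val := by
    ext1 <;> simp [QuadraticAlgebra.re_one, QuadraticAlgebra.im_one]; ring

/-- The polynomial `x_n` in `x_n + y_n w = (z + w) ^ n`. -/
def pellX (n : ℤ) : ℂ[X] := ((zAddW ^ n : (QuadraticAlgebra ℂ[X] (X ^ 2 - 1) 0)ˣ) :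
  QuadraticAlgebra ℂ[X] (X ^ 2 - 1) 0).re

/-- The polynomial `y_n` in `x_n + y_n w = (z + w) ^ n`. -/
def pellY (n : ℤ) : ℂ[X] := ((zAddW ^ n : (QuadraticAlgebra ℂ[X] (X ^ 2 - 1) 0)ˣ) :
  QuadraticAlgebra ℂ[X] (X ^ 2 - 1) 0).im

/-- A solution `(x, y)` in entire functions of `x ^ 2 - (z ^ 2 - 1) * y ^ 2 = 1`. -/
@[ext]
structure PellSolution where
  x : Entire
  y : Entire
  pell : x ^ 2 - (coordZ ^ 2 - 1) * y ^ 2 = 1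

namespace PellSolution

instance : Add PellSolution where
  add a b :=
    { x := a.x * b.x + (coordZ ^ 2 - 1) * a.y * b.y
      y := a.x * b.y + a.y * b.x
      pell := by
        linear_combination (b.x ^ 2 - (coordZ ^ 2 - 1) * b.y ^ 2) * a.pell + b.pell }

instance : Zero PellSolution := ⟨⟨1, 0, by ring⟩⟩

instance : Neg PellSolution :=
  ⟨fun a => ⟨a.x, -a.y, by linear_combination a.pell⟩⟩

theorem add_x (a b : PellSolution) :
    (a + b).x = a.x * b.x + (coordZ ^ 2 - 1) * a.y * b.y := rfl

theorem add_y (a b : PellSolution) : (a + b).y = a.x * b.y + a.y * b.x := rfl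

theorem zero_x : (0 : PellSolution).x = 1 := rfl

theorem zero_y : (0 : PellSolution).y = 0 := rfl

theorem neg_x (a : PellSolution) : (-a).x = a.x := rfl

theorem neg_y (a : PellSolution) : (-a).y = -a.y := rfl

/-- The group of solutions; `k • a` is the `k`-th multiple of `a` in it. -/
instance : AddCommGroup PellSolution where
  add_assoc a b c := by
    apply PellSolution.ext <;> simp only [add_x, add_y] <;> ring
  zero_add a := by
    apply PellSolution.ext <;> simp only [add_x, add_y, zero_x, zero_y] <;> ring
  add_zero a := by
    apply PellSolution.ext <;> simp only [add_x, add_y, zero_x, zero_y] <;> ring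
  nsmul := nsmulRec
  zsmul := zsmulRec
  neg_add_cancel a := by
    apply PellSolution.ext
    · simp only [add_x, neg_x, neg_y, zero_x]
      linear_combination a.pell
    · simp only [add_y, neg_x, neg_y, zero_y]
      ring
  add_comm a b := by
    apply PellSolution.ext <;> simp only [add_x, add_y] <;> ring

/-- Both components have order at most `ρ`. -/
def InBoundedOrder (ρ : ℝ) (a : PellSolution) : Prop :=
  a.x ∈ boundedOrder ρ ∧ a.y ∈ boundedOrder ρ

end PellSolution

end

/-! Put `z = cosh u`, `w = sinh u`. A solution becomes the entire, zero-free, `2πi`-periodic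
function `E(u) = x + y w` (`pellExp`), with `E(u) E(-u) = 1`, and the group law becomes
multiplication. Hence `E = exp (n u + h)` with `h` periodic, and order at most `ρ` forces `h` to be
a Laurent polynomial in `e ^ u` of degree at most `d = ⌊ρ⌋` (`exists_pellExp_eq`).

Apply this to the `k`-th root `b`. Since `y_k` divides the `y` of `k • b`, `E_b ^ k = ±1` at the
zeros of `sinh (k u)`, in particular at `u = 2πi r / p`. So `h` takes values in `(2πi / 2k) ℤ` at
all `p`-th roots of unity. As `p > 2d + 1`, the frequency `d + 1` is absent from `h` mod `p`. This
gives an integer relation between the `p`-th roots of unity, and such a relation has equal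
coefficients; so `h` is constant on them, hence constant (`IsPrimitiveRoot.laurent_coeff_eq_zero`).
Then `E_b = ± e ^ (n u)`, and `y = ± y_{kn} = y_{±kn}`.

Conversely, `(x_l, y_l)` is a `k`-th root of `(x_{kl}, y_{kl})`, and `y_k ∣ y_{kl}` by the addition
formula. -/

noncomputable section

/-! ### Laurent polynomials at `p`-th roots of unity -/

theorem IsPrimitiveRoot.sum_zpow_mul_eq_zero {p : ℕ} {ζ : ℂ} (hζ : IsPrimitiveRoot ζ p) (l : ℤ)
    (hl : ¬ (p : ℤ) ∣ l) : ∑ r : Fin p, ζ ^ (l * (r : ℤ)) = 0 := by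
  have h1 : ζ ^ l ≠ 1 := fun h => hl ((hζ.zpow_eq_one_iff_dvd l).1 h)
  have h2 : ∑ r : Fin p, ζ ^ (l * (r : ℤ)) = ∑ r ∈ Finset.range p, (ζ ^ l) ^ r := by
    rw [Finset.sum_range]
    exact Finset.sum_congr rfl fun r _ => by rw [zpow_mul, zpow_natCast]
  rw [h2, geom_sum_eq h1, ← zpow_natCast, ← zpow_mul, mul_comm, zpow_mul, zpow_natCast,
    hζ.pow_eq_one]
  simp

theorem sum_laurent_mul_zpow {ζ : ℂ} (hζ0 : ζ ≠ 0) (p d : ℕ) (a : ℤ → ℂ) (i : ℤ) :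
    ∑ r : Fin p, (∑ j ∈ Finset.Icc (-(d : ℤ)) d, a j * ζ ^ (j * (r : ℤ))) * ζ ^ (-i * (r : ℤ)) =
      ∑ j ∈ Finset.Icc (-(d : ℤ)) d, a j * ∑ r : Fin p, ζ ^ ((j - i) * (r : ℤ)) := by
  simp_rw [Finset.sum_mul, Finset.mul_sum]
  rw [Finset.sum_comm]
  refine Finset.sum_congr rfl fun j _ => Finset.sum_congr rfl fun r _ => ?_
  rw [mul_assoc, ← zpow_add₀ hζ0]
  congr 2
  ring

/-- A Laurent polynomial of degree small compared with the prime `p`, whose values at the `p`-th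
roots of unity are integral multiples of a common constant, is constant. -/
theorem IsPrimitiveRoot.laurent_coeff_eq_zero {p : ℕ} (hp : p.Prime) {ζ : ℂ}
    (hζ : IsPrimitiveRoot ζ p) {d : ℕ} (hd : 2 * d + 1 < p) (a : ℤ → ℂ) {c : ℂ} (hc : c ≠ 0)
    (b : Fin p → ℤ)
    (hb : ∀ r : Fin p, ∑ j ∈ Finset.Icc (-(d : ℤ)) d, a j * ζ ^ (j * (r : ℤ)) = c * b r)
    {i : ℤ} (hi : i ∈ Finset.Icc (-(d : ℤ)) d) (hi0 : i ≠ 0) : a i = 0 := by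
  have hζ0 : ζ ≠ 0 := hζ.ne_zero hp.ne_zero
  have key := fun i : ℤ => sum_laurent_mul_zpow hζ0 p d a i
  simp_rw [hb] at key
  have hndvd : ∀ l : ℤ, l ≠ 0 → |l| < p → ¬ (p : ℤ) ∣ l := fun l hl hlp hdvd =>
    hl (Int.eq_zero_of_abs_lt_dvd hdvd hlp)
  -- Frequency `d + 1` lies outside the spectrum: `j - (d + 1)` runs over `[-2d - 1, -1]`, which
  -- contains no multiple of `p`.
  have hprim : IsPrimitiveRoot ((ζ ^ (d + 1))⁻¹) p := by
    refine (hζ.pow_of_coprime (d + 1) (Nat.Coprime.symm ?_)).inv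
    exact (hp.coprime_iff_not_dvd).2 (Nat.not_dvd_of_pos_of_lt d.succ_pos (by omega))
  have hzero : ∑ r : Fin p, (b r : ℂ) * ((ζ ^ (d + 1))⁻¹) ^ (r : ℕ) = 0 := by
    have h := key (d + 1)
    have hr : ∑ j ∈ Finset.Icc (-(d : ℤ)) d,
        a j * ∑ r : Fin p, ζ ^ ((j - ((d : ℤ) + 1)) * (r : ℤ)) = 0 := by
      refine Finset.sum_eq_zero fun j hj => ?_
      rw [Finset.mem_Icc] at hj
      rw [hζ.sum_zpow_mul_eq_zero _ (hndvd _ (by omega) (abs_lt.2 ⟨by omega, by omega⟩)), mul_zero]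
    rw [hr] at h
    have h' : c * ∑ r : Fin p, (b r : ℂ) * ((ζ ^ (d + 1))⁻¹) ^ (r : ℕ) = 0 := by
      rw [← h, Finset.mul_sum]
      refine Finset.sum_congr rfl fun r _ => ?_
      rw [mul_assoc, zpow_mul, zpow_neg, zpow_natCast]
      norm_cast
    exact (mul_eq_zero.1 h').resolve_left hc
  -- The `p`-th cyclotomic polynomial `1 + X + ... + X ^ (p - 1)` is irreducible over `ℚ`, so all `b
  -- r` agree.
  have hconst := (hprim.sum_eq_zero_iff_forall_eq_int hp b).1 hzero
  have hi' := Finset.mem_Icc.1 hi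
  have h := key i
  have hl : ∑ r : Fin p, c * (b r : ℂ) * ζ ^ (-i * (r : ℤ)) = 0 := by
    have : ∀ r : Fin p, c * (b r : ℂ) * ζ ^ (-i * (r : ℤ)) =
        c * (b ⟨0, hp.pos⟩ : ℂ) * ζ ^ (-i * (r : ℤ)) := fun r => by
      rw [hconst r ⟨0, hp.pos⟩]
    rw [Finset.sum_congr rfl fun r _ => this r, ← Finset.mul_sum,
      hζ.sum_zpow_mul_eq_zero _ (hndvd _ (by omega) (abs_lt.2 ⟨by omega, by omega⟩)), mul_zero]
  rw [hl, Finset.sum_eq_single_of_mem i hi] at h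
  · simp only [sub_self, zero_mul, zpow_zero, Finset.sum_const, Finset.card_univ, Fintype.card_fin,
      nsmul_eq_mul, mul_one] at h
    exact (mul_eq_zero.1 h.symm).resolve_right (Nat.cast_ne_zero.2 hp.ne_zero)
  · intro j hj hji
    rw [Finset.mem_Icc] at hj
    rw [hζ.sum_zpow_mul_eq_zero _ (hndvd _ (by omega) (abs_lt.2 ⟨by omega, by omega⟩)), mul_zero]

/-! ### Fourier coefficients of periodic entire functions -/

section Fourier
open Complex MeasureTheory

/-- The Laurent coefficients, computed on a vertical period, of a `2πi`-periodic entire function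
do not depend on the abscissa. -/
theorem integral_vertical_period_eq {f : ℂ → ℂ} (hf : Differentiable ℂ f)
    (hper : ∀ u, f (u + 2 * Real.pi * I) = f u) (c : ℝ) :
    ∫ y in (0 : ℝ)..2 * Real.pi, f (c + y * I) = ∫ y in (0 : ℝ)..2 * Real.pi, f (y * I) := by
  have h := integral_boundary_rect_eq_zero_of_differentiableOn f 0
    ((c : ℂ) + ((2 * Real.pi : ℝ) : ℂ) * I) hf.differentiableOn
  have h2 : ∀ x : ℝ, f (x + 2 * Real.pi * I) = f x := fun x => hper x
  simp [h2] at h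
  have h3 : I * (∫ y in (0 : ℝ)..2 * Real.pi, f (c + y * I)) =
      I * ∫ y in (0 : ℝ)..2 * Real.pi, f (y * I) := by linear_combination h
  exact mul_left_cancel₀ I_ne_zero h3

/-- The coefficient of `e ^ (j u)` in a `2πi`-periodic entire function, up to a factor `2π`. -/
def expCoeff (h : ℂ → ℂ) (j : ℤ) : ℂ :=
  ∫ y in (0 : ℝ)..2 * Real.pi, h (y * I) * exp (-j * (y * I))

theorem integral_mul_exp_eq_expCoeff {h : ℂ → ℂ} (hh : Differentiable ℂ h)
    (hper : ∀ u, h (u + 2 * Real.pi * I) = h u) (j : ℤ) (c : ℝ) :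
    ∫ y in (0 : ℝ)..2 * Real.pi, h (c + y * I) * exp (-j * (y * I)) =
      expCoeff h j * exp (j * c) := by
  have h1 := integral_vertical_period_eq (f := fun u => h u * exp (-j * u))
    (by fun_prop) (fun u => by
      rw [hper]
      congr 1
      have : (-(j : ℂ)) * (u + 2 * Real.pi * I) = -j * u + ((-j : ℤ) : ℂ) * (2 * Real.pi * I) := by
        push_cast; ring
      rw [this, exp_add, exp_int_mul_two_pi_mul_I, mul_one]) c
  rw [expCoeff, ← h1, ← intervalIntegral.integral_mul_const]
  refine intervalIntegral.integral_congr fun y _ => ?_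
  rw [mul_assoc, ← exp_add]
  congr 2
  ring

/-- Only the real part is controlled, so write `h = 2 Re h - conj h` on the vertical line;
conjugation turns the coefficient of index `j` into the conjugate of the one of index `-j`. -/
theorem norm_expCoeff_mul_le {h : ℂ → ℂ} (hh : Differentiable ℂ h)
    (hper : ∀ u, h (u + 2 * Real.pi * I) = h u) {B c : ℝ}
    (hB : ∀ y : ℝ, |(h (c + y * I)).re| ≤ B) (j : ℤ) :
    ‖expCoeff h j‖ * Real.exp (j * c) ≤
      ‖expCoeff h (-j)‖ * Real.exp (-j * c) + 4 * Real.pi * B := by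
  have hcont : Continuous h := hh.continuous
  have e1 := integral_mul_exp_eq_expCoeff hh hper j c
  have e2 := integral_mul_exp_eq_expCoeff hh hper (-j) c
  have e3 : ∫ y in (0 : ℝ)..2 * Real.pi, (starRingEnd ℂ) (h (c + y * I)) * exp (-j * (y * I)) =
      (starRingEnd ℂ) (expCoeff h (-j) * exp ((-j : ℤ) * c)) := by
    rw [← e2, ← intervalIntegral.intervalIntegral_conj]
    refine intervalIntegral.integral_congr fun y _ => ?_
    simp [← exp_conj]
  have e4 : expCoeff h j * exp (j * c) =
      (∫ y in (0 : ℝ)..2 * Real.pi, (2 * (h (c + y * I)).re : ℂ) * exp (-j * (y * I))) -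
      (starRingEnd ℂ) (expCoeff h (-j) * exp ((-j : ℤ) * c)) := by
    rw [← e1, ← e3, ← intervalIntegral.integral_sub]
    · refine intervalIntegral.integral_congr fun y _ => ?_
      rw [← sub_mul]
      congr 1
      have := add_conj (h (c + y * I))
      push_cast at this
      linear_combination this
    · exact Continuous.intervalIntegrable (by fun_prop) _ _
    · exact Continuous.intervalIntegrable (by fun_prop) _ _
  have e5 : ‖∫ y in (0 : ℝ)..2 * Real.pi, (2 * (h (c + y * I)).re : ℂ) * exp (-j * (y * I))‖ ≤
      (2 * B) * |2 * Real.pi - 0| := by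
    refine intervalIntegral.norm_integral_le_of_norm_le_const fun y _ => ?_
    have : ‖exp (-j * (y * I))‖ = 1 := by
      rw [norm_exp]; simp
    rw [norm_mul, this, mul_one, norm_mul, norm_real]
    simpa using hB y
  have n1 : ‖exp (j * c)‖ = Real.exp (j * c) := by rw [norm_exp]; simp
  have n2 : ‖exp ((-j : ℤ) * c)‖ = Real.exp (-j * c) := by rw [norm_exp]; simp
  have e6 := norm_sub_le
    (∫ y in (0 : ℝ)..2 * Real.pi, (2 * (h (c + y * I)).re : ℂ) * exp (-j * (y * I)))
    ((starRingEnd ℂ) (expCoeff h (-j) * exp ((-j : ℤ) * c)))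
  rw [← e4, RCLike.norm_conj, norm_mul, norm_mul, n1, n2] at e6
  rw [sub_zero, abs_of_pos Real.two_pi_pos] at e5
  linarith

theorem expCoeff_eq_zero {h : ℂ → ℂ} (hh : Differentiable ℂ h)
    (hper : ∀ u, h (u + 2 * Real.pi * I) = h u) {B σ : ℝ} (hσ : 0 ≤ σ)
    (hB : ∀ u : ℂ, |(h u).re| ≤ B * Real.exp (σ * |u.re|)) {j : ℤ} (hj : σ < |(j : ℝ)|) :
    expCoeff h j = 0 := by
  have hbound : ∀ x : ℝ, 0 ≤ x → ‖expCoeff h j‖ ≤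
      ‖expCoeff h (-j)‖ * Real.exp (-(2 * |(j : ℝ)|) * x) +
        4 * Real.pi * B * Real.exp (-(|(j : ℝ)| - σ) * x) := by
    intro x hx
    -- The sign of the abscissa `c` is that of `j`, so that the weight of `j` grows and that of `-j`
    -- decays.
    have hs : ∃ c : ℝ, j * c = |(j : ℝ)| * x ∧ |c| = x := by
      rcases le_total 0 (j : ℝ) with h0 | h0
      · exact ⟨x, by rw [abs_of_nonneg h0], abs_of_nonneg hx⟩
      · exact ⟨-x, by rw [abs_of_nonpos h0]; ring, by rw [abs_neg, abs_of_nonneg hx]⟩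
    obtain ⟨c, hc1, hc2⟩ := hs
    have := norm_expCoeff_mul_le hh hper (c := c) (B := B * Real.exp (σ * x))
      (fun y => by simpa [hc2] using hB (c + y * I)) j
    rw [neg_mul, hc1] at this
    have h2 := mul_le_mul_of_nonneg_right this (Real.exp_pos (-(|(j : ℝ)| * x))).le
    rw [add_mul, mul_assoc, mul_assoc ‖expCoeff h (-j)‖, ← Real.exp_add, ← Real.exp_add,
      add_neg_cancel, Real.exp_zero, mul_one] at h2
    have x1 : -(2 * |(j : ℝ)|) * x = -(|(j : ℝ)| * x) + -(|(j : ℝ)| * x) := by ring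
    have x2 : -(|(j : ℝ)| - σ) * x = σ * x + -(|(j : ℝ)| * x) := by ring
    rw [x1, x2, Real.exp_add (σ * x)]
    linarith
  have hexp : ∀ κ : ℝ, 0 < κ → Tendsto (fun x : ℝ => Real.exp (-κ * x)) atTop (nhds 0) := by
    intro κ hκ
    refine Real.tendsto_exp_atBot.comp ?_
    exact tendsto_id.const_mul_atTop_of_neg (neg_lt_zero.2 hκ)
  have hlim := ((hexp (2 * |(j : ℝ)|) (by linarith)).const_mul ‖expCoeff h (-j)‖).add
    ((hexp (|(j : ℝ)| - σ) (by linarith)).const_mul (4 * Real.pi * B))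
  rw [mul_zero, mul_zero, add_zero] at hlim
  have : ‖expCoeff h j‖ ≤ 0 :=
    ge_of_tendsto hlim ((eventually_ge_atTop 0).mono fun x hx => hbound x hx)
  exact norm_le_zero_iff.1 this

/-- On the vertical line through `u` the Fourier series is finite, hence summable, so it represents
`h` pointwise. -/
theorem eq_sum_of_expCoeff_eq_zero {h : ℂ → ℂ} (hh : Differentiable ℂ h)
    (hper : ∀ u, h (u + 2 * Real.pi * I) = h u) (s : Finset ℤ)
    (hs : ∀ j ∉ s, expCoeff h j = 0) (u : ℂ) :
    h u = ∑ j ∈ s, (2 * Real.pi : ℂ)⁻¹ * expCoeff h j * exp (j * u) := by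
  have : Fact (0 < 2 * Real.pi) := ⟨Real.two_pi_pos⟩
  have hp : Function.Periodic (fun y : ℝ => h (u.re + y * I)) (2 * Real.pi) := by
    intro y
    simp only
    rw [← hper (u.re + y * I)]
    congr 1
    push_cast
    ring
  let F : C(AddCircle (2 * Real.pi), ℂ) :=
    ⟨hp.lift, continuous_coinduced_dom.2 (hh.continuous.comp (by fun_prop))⟩
  have hF : ∀ y : ℝ, F (y : AddCircle (2 * Real.pi)) = h (u.re + y * I) := fun y => rfl
  have hcoeff : ∀ j : ℤ, fourierCoeff F j =
      (2 * Real.pi : ℂ)⁻¹ * expCoeff h j * exp (j * u.re) := by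
    intro j
    rw [fourierCoeff_eq_intervalIntegral F j 0, zero_add, mul_assoc,
      ← integral_mul_exp_eq_expCoeff hh hper j u.re, real_smul]
    congr 1
    · push_cast; rw [one_div]
    · refine intervalIntegral.integral_congr fun y _ => ?_
      simp only [hF, fourier_coe_apply, smul_eq_mul]
      rw [mul_comm]
      congr 2
      push_cast
      have : (Real.pi : ℂ) ≠ 0 := by exact_mod_cast Real.pi_ne_zero
      field_simp
  have hz : ∀ j ∉ s, fourierCoeff F j = 0 := fun j hj => by rw [hcoeff, hs j hj]; simp
  have hsum : Summable (fourierCoeff F) := summable_of_ne_finset_zero (s := s) hz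
  have h1 := has_pointwise_sum_fourier_series_of_summable hsum (u.im : AddCircle (2 * Real.pi))
  have h2 := h1.unique (hasSum_sum_of_ne_finset_zero (s := s) fun j hj => by rw [hz j hj, zero_smul])
  rw [hF, re_add_im] at h2
  rw [h2]
  refine Finset.sum_congr rfl fun j _ => ?_
  rw [hcoeff, fourier_coe_apply, smul_eq_mul, mul_assoc _ (exp _), ← exp_add]
  congr 2
  have hu : (j : ℂ) * u = j * (u.re + u.im * I) := by rw [re_add_im]
  rw [hu]
  have : (Real.pi : ℂ) ≠ 0 := by exact_mod_cast Real.pi_ne_zero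
  push_cast
  field_simp

/-- A `2πi`-periodic entire function whose real part is `O(e ^ (σ |Re u|))` with `σ < d + 1` is a
Laurent polynomial in `e ^ u` of degree at most `d`. -/
theorem exists_laurent_of_re_le {h : ℂ → ℂ} (hh : Differentiable ℂ h)
    (hper : ∀ u, h (u + 2 * Real.pi * I) = h u) {B σ : ℝ} (hσ : 0 ≤ σ)
    (hB : ∀ u : ℂ, |(h u).re| ≤ B * Real.exp (σ * |u.re|)) {d : ℕ} (hd : σ < d + 1) :
    ∃ a : ℤ → ℂ, ∀ u, h u = ∑ j ∈ Finset.Icc (-(d : ℤ)) d, a j * exp (j * u) := by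
  refine ⟨_, eq_sum_of_expCoeff_eq_zero hh hper _ fun j hj => expCoeff_eq_zero hh hper hσ hB ?_⟩
  have hj' : (d : ℤ) + 1 ≤ |j| := by
    by_contra hlt
    exact hj (Finset.mem_Icc.2 (abs_le.1 (by omega)))
  have : ((d : ℝ) + 1) ≤ |(j : ℝ)| := by exact_mod_cast hj'
  linarith

end Fourier

/-! ### Growth bounds and the order of polynomials -/

section Growth

theorem bddAbove_norm_image_closedBall (f : Entire) (r : ℝ) :
    BddAbove ((fun z : ℂ => ‖f.1 z‖) '' Metric.closedBall 0 r) :=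
  ((isCompact_closedBall 0 r).image (Differentiable.continuous f.2).norm).bddAbove

theorem norm_le_maxModulus (f : Entire) {z : ℂ} {r : ℝ} (hz : ‖z‖ ≤ r) :
    ‖f.1 z‖ ≤ maxModulus f r :=
  le_csSup (bddAbove_norm_image_closedBall f r) ⟨z, by simpa using hz, rfl⟩

theorem exists_norm_le_exp_rpow {ρ σ : ℝ} (hσ : ρ < σ) (hσ0 : 0 < σ) {f : Entire}
    (hf : f ∈ boundedOrder ρ) :
    ∃ C : ℝ, 0 ≤ C ∧ ∀ (z : ℂ) (R : ℝ), 1 ≤ R → ‖z‖ ≤ R → ‖f.1 z‖ ≤ Real.exp (C * R ^ σ) := by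
  have hlt : growthOrder f < ENNReal.ofReal σ :=
    lt_of_le_of_lt hf ((ENNReal.ofReal_lt_ofReal_iff hσ0).2 hσ)
  simp only [growthOrder, iInf_lt_iff] at hlt
  obtain ⟨α, ⟨C, hC⟩, hα⟩ := hlt
  have hασ : (α : ℝ) < σ := by
    rw [ENNReal.ofReal, ENNReal.coe_lt_coe, Real.lt_toNNReal_iff_coe_lt] at hα
    exact hα
  obtain ⟨R₀, hR₀⟩ := eventually_atTop.1 hC
  -- The second summand covers `R ≤ R₀`, through `M ≤ exp M`.
  refine ⟨max C 0 + maxModulus f R₀ ⊔ 0, by positivity, fun z R hR hz => ?_⟩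
  have h1 : (1 : ℝ) ≤ R ^ σ := Real.one_le_rpow hR hσ0.le
  rcases le_total R₀ R with hle | hle
  · rcases (norm_nonneg (f.1 z)).eq_or_lt with h0 | h0
    · rw [← h0]; positivity
    have hM := norm_le_maxModulus f hz
    rw [← Real.log_le_iff_le_exp h0]
    calc Real.log ‖f.1 z‖ ≤ Real.log (maxModulus f R) := Real.log_le_log h0 hM
      _ ≤ C * R ^ (α : ℝ) := hR₀ R hle
      _ ≤ max C 0 * R ^ σ := by
        gcongr
        exact le_max_left _ _
      _ ≤ _ := by gcongr; simp
  · have hM := norm_le_maxModulus f (hz.trans hle)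
    calc ‖f.1 z‖ ≤ (max C 0 + maxModulus f R₀ ⊔ 0) * 1 := by
          rw [mul_one]
          exact (hM.trans (le_max_left _ 0)).trans (le_add_of_nonneg_left (le_max_right _ _))
      _ ≤ (max C 0 + maxModulus f R₀ ⊔ 0) * R ^ σ := by gcongr
      _ ≤ _ := (by linarith [Real.add_one_le_exp ((max C 0 + maxModulus f R₀ ⊔ 0) * R ^ σ)])

theorem exists_norm_eval_le (P : ℂ[X]) :
    ∃ (A : ℝ) (N : ℕ), 1 ≤ A ∧ ∀ (z : ℂ) (r : ℝ), 1 ≤ r → ‖z‖ ≤ r → ‖P.eval z‖ ≤ A * r ^ N := by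
  refine ⟨1 + ∑ i ∈ Finset.range (P.natDegree + 1), ‖P.coeff i‖, P.natDegree,
    le_add_of_nonneg_right (by positivity), fun z r hr hz => ?_⟩
  rw [eval_eq_sum_range, add_mul, Finset.sum_mul]
  refine (norm_sum_le _ _).trans (le_add_of_nonneg_of_le (by positivity) ?_)
  refine Finset.sum_le_sum fun i hi => ?_
  rw [norm_mul, norm_pow]
  gcongr
  calc ‖z‖ ^ i ≤ r ^ i := by gcongr
    _ ≤ r ^ P.natDegree := pow_le_pow_right₀ hr (by simpa [Nat.lt_succ_iff] using hi)

theorem polyEntire_mem_boundedOrder (ρ : ℝ) (P : ℂ[X]) : polyEntire P ∈ boundedOrder ρ := by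
  have h0 : growthOrder (polyEntire P) ≤ 0 := by
    -- The exponent `α = 0` fails for a nonconstant polynomial; every `α > 0` is admissible, and the
    -- infimum is `0`.
    refine le_of_forall_gt fun c hc => ?_
    obtain ⟨α, hα0, hαc⟩ := ENNReal.lt_iff_exists_nnreal_btwn.1 hc
    refine lt_of_le_of_lt (iInf₂_le α ⟨1, ?_⟩) hαc
    have hα : (0 : ℝ) < α := by exact_mod_cast hα0
    obtain ⟨A, N, hA, hP⟩ := exists_norm_eval_le P
    have hlo : (fun r : ℝ => Real.log A + N * Real.log r) =o[atTop] fun r => r ^ (α : ℝ) := by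
      refine Asymptotics.IsLittleO.add ?_ ((isLittleO_log_rpow_atTop hα).const_mul_left _)
      exact Asymptotics.isLittleO_const_left.2
        (Or.inr (tendsto_norm_atTop_atTop.comp (tendsto_rpow_atTop hα)))
    filter_upwards [hlo.bound one_pos, eventually_ge_atTop 1] with r hr hr1
    have hr0 : 0 < r := by linarith
    rw [Real.norm_eq_abs, Real.norm_eq_abs, abs_of_nonneg (Real.rpow_nonneg hr0.le _)] at hr
    refine le_trans ?_ ((le_abs_self _).trans hr)
    have hM : maxModulus (polyEntire P) r ≤ A * r ^ N := by
      refine csSup_le ((Metric.nonempty_closedBall.2 hr0.le).image _) ?_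
      rintro _ ⟨z, hz, rfl⟩
      exact hP z r hr1 (by simpa using hz)
    have hM0 : 0 ≤ maxModulus (polyEntire P) r :=
      (norm_nonneg _).trans (norm_le_maxModulus (polyEntire P) (z := 0) (by simpa using hr0.le))
    have hl : Real.log (A * r ^ N) = Real.log A + N * Real.log r := by
      rw [Real.log_mul (by positivity) (by positivity), Real.log_pow]
    rw [← hl]
    rcases hM0.eq_or_lt with h0 | h0
    · rw [← h0, Real.log_zero]
      exact Real.log_nonneg (one_le_mul_of_one_le_of_one_le hA (one_le_pow₀ hr1))
    · exact Real.log_le_log h0 hM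
  exact h0.trans zero_le

end Growth

/-! ### Logarithms of zero-free entire functions -/

section Exponential
open Complex

/-- `L` is a primitive of `G' / G` normalised at `0`; then `G e ^ (-L)` has zero derivative. -/
theorem exists_entire_log {G : ℂ → ℂ} (hG : Differentiable ℂ G) (h0 : ∀ u, G u ≠ 0) :
    ∃ L : ℂ → ℂ, Differentiable ℂ L ∧ ∀ u, G u = exp (L u) := by
  have hdG : Differentiable ℂ (deriv G) := by
    simpa using (hG.contDiff (n := 2)).differentiable_deriv_two
  obtain ⟨L, hL0, hL⟩ := ((hdG.div hG h0).isExactOn_univ).with_val_at 0 (log (G 0))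
  have hLd : Differentiable ℂ L := fun u => (hL u trivial).differentiableAt
  refine ⟨L, hLd, fun u => ?_⟩
  have hderiv : ∀ v, HasDerivAt (fun v => G v * exp (-L v)) 0 v := fun v => by
    have := (hG v).hasDerivAt.mul ((hL v trivial).neg.cexp)
    refine this.congr_deriv ?_
    simp only [Pi.div_apply, Pi.neg_apply]
    field_simp [h0 v]
    ring
  have hc : G u * exp (-L u) = G 0 * exp (-L 0) :=
    is_const_of_deriv_eq_zero (fun v => (hderiv v).differentiableAt)
      (fun v => (hderiv v).deriv) u 0
  rw [hL0, exp_neg (log _), exp_log (h0 0), mul_inv_cancel₀ (h0 0), exp_neg] at hc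
  exact (mul_inv_eq_one₀ (exp_ne_zero _)).1 hc

/-- A zero-free `2πi`-periodic entire function is `e ^ (n u + h u)` with `h` periodic. -/
theorem exists_periodic_log {G : ℂ → ℂ} (hG : Differentiable ℂ G) (h0 : ∀ u, G u ≠ 0)
    (hper : ∀ u, G (u + 2 * Real.pi * I) = G u) :
    ∃ (n : ℤ) (h : ℂ → ℂ), Differentiable ℂ h ∧ (∀ u, h (u + 2 * Real.pi * I) = h u) ∧
      ∀ u, G u = exp (n * u + h u) := by
  obtain ⟨L, hL, hGL⟩ := exists_entire_log hG h0
  -- The increment of `L` over a period lies in `2πi ℤ` and has zero derivative, so a single `n`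
  -- serves; subtracting `n u` makes `L` periodic.
  have hmul : ∀ u, ∃ n : ℤ, L (u + 2 * Real.pi * I) - L u = n * (2 * Real.pi * I) := fun u => by
    rw [← exp_eq_one_iff, exp_sub, ← hGL, ← hGL, hper, div_self (h0 u)]
  have hd : ∀ u, HasDerivAt (fun u => L (u + 2 * Real.pi * I) - L u) 0 u := fun u => by
    have h1 : ∀ u, deriv L u = deriv G u / G u := fun u => by
      have := (hL u).hasDerivAt.cexp
      rw [← funext hGL, ← hGL] at this
      rw [this.deriv, mul_div_cancel_left₀ _ (h0 u)]
    have h2 : deriv G (u + 2 * Real.pi * I) = deriv G u := by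
      rw [← deriv_comp_add_const, funext hper]
    have h3 := ((hL (u + 2 * Real.pi * I)).hasDerivAt.comp_add_const u (2 * Real.pi * I)).sub
      (hL u).hasDerivAt
    rwa [h1, h1, h2, hper, sub_self] at h3
  obtain ⟨n, hn⟩ := hmul 0
  refine ⟨n, fun u => L u - n * u, by fun_prop, fun u => ?_, fun u => by rw [hGL]; congr 1; ring⟩
  have hc := is_const_of_deriv_eq_zero (fun v => (hd v).differentiableAt)
      (fun v => (hd v).deriv) u 0
  rw [hn] at hc
  linear_combination hc

end Exponential

/-! ### Pell solutions as periodic functions -/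

section Pell
open Complex

theorem Complex.cosh_surjective : Function.Surjective cosh := fun z => by
  obtain ⟨v, hv⟩ := cos_surjective z
  exact ⟨v * I, by rw [cosh_mul_I, hv]⟩

theorem Entire.ext_cosh {f g : Entire} (h : ∀ u, f.1 (cosh u) = g.1 (cosh u)) : f = g := by
  refine Subtype.ext (funext fun z => ?_)
  obtain ⟨u, rfl⟩ := cosh_surjective z
  exact h u

/-- The factor `sinh u` vanishes only over `z = ±1`, and continuity recovers these two points. -/
theorem Entire.ext_cosh_mul_sinh {f g : Entire}
    (h : ∀ u, f.1 (cosh u) * sinh u = g.1 (cosh u) * sinh u) : f = g := by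
  refine Subtype.ext (Continuous.ext_on (s := {1, -1}ᶜ) ?_ (Differentiable.continuous f.2)
    (Differentiable.continuous g.2) fun z hz => ?_)
  · exact (Set.toFinite _).countable.dense_compl ℂ
  · obtain ⟨u, rfl⟩ := cosh_surjective z
    refine mul_right_cancel₀ (fun h0 => hz ?_) (h u)
    have := cosh_sq_sub_sinh_sq u
    rw [h0] at this
    exact sq_eq_sq_iff_eq_or_eq_neg.1 (by linear_combination this)

/-- The function `x + y w` of a solution, after the substitution `z = cosh u`, `w = sinh u`. -/
def pellExp (b : PellSolution) (u : ℂ) : ℂ := b.x.1 (cosh u) + b.y.1 (cosh u) * sinh u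

theorem PellSolution.pell_cosh (b : PellSolution) (u : ℂ) :
    b.x.1 (cosh u) ^ 2 - (b.y.1 (cosh u) * sinh u) ^ 2 = 1 := by
  have h : b.x.1 (cosh u) ^ 2 - ((X : ℂ[X]).eval (cosh u) ^ 2 - 1) * b.y.1 (cosh u) ^ 2 = 1 :=
    congrFun (congrArg Subtype.val b.pell) (cosh u)
  rw [eval_X] at h
  linear_combination h + b.y.1 (cosh u) ^ 2 * cosh_sq_sub_sinh_sq u

theorem pellExp_zero (u : ℂ) : pellExp 0 u = 1 := by
  have : pellExp 0 u = 1 + 0 * sinh u := rfl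
  rw [this]; ring

theorem pellExp_add (a b : PellSolution) (u : ℂ) :
    pellExp (a + b) u = pellExp a u * pellExp b u := by
  have : pellExp (a + b) u = a.x.1 (cosh u) * b.x.1 (cosh u) +
      ((X : ℂ[X]).eval (cosh u) ^ 2 - 1) * a.y.1 (cosh u) * b.y.1 (cosh u) +
      (a.x.1 (cosh u) * b.y.1 (cosh u) + a.y.1 (cosh u) * b.x.1 (cosh u)) * sinh u := rfl
  rw [this, pellExp, pellExp, eval_X]
  linear_combination a.y.1 (cosh u) * b.y.1 (cosh u) * cosh_sq_sub_sinh_sq u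

theorem pellExp_nsmul (k : ℕ) (b : PellSolution) (u : ℂ) :
    pellExp (k • b) u = pellExp b u ^ k := by
  induction k with
  | zero => rw [zero_smul, pellExp_zero, pow_zero]
  | succ k ih => rw [succ_nsmul, pellExp_add, ih, pow_succ]

theorem pellExp_neg_arg (b : PellSolution) (u : ℂ) :
    pellExp b (-u) = b.x.1 (cosh u) - b.y.1 (cosh u) * sinh u := by
  rw [pellExp, cosh_neg, sinh_neg]; ring

theorem pellExp_mul_neg_arg (b : PellSolution) (u : ℂ) : pellExp b u * pellExp b (-u) = 1 := by
  rw [pellExp_neg_arg, pellExp]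
  linear_combination b.pell_cosh u

theorem pellExp_ne_zero (b : PellSolution) (u : ℂ) : pellExp b u ≠ 0 :=
  left_ne_zero_of_mul_eq_one (pellExp_mul_neg_arg b u)

theorem pellExp_periodic (b : PellSolution) (u : ℂ) :
    pellExp b (u + 2 * Real.pi * I) = pellExp b u := by
  have h1 : exp (u + 2 * Real.pi * I) = exp u := exp_periodic u
  have h2 : exp (-(u + 2 * Real.pi * I)) = exp (-u) := by rw [exp_neg, h1, exp_neg]
  simp only [pellExp, cosh, sinh, h1, h2]

theorem differentiable_pellExp (b : PellSolution) : Differentiable ℂ (pellExp b) :=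
  (Differentiable.comp b.x.2 differentiable_cosh).add
    ((Differentiable.comp b.y.2 differentiable_cosh).mul differentiable_sinh)

theorem PellSolution.ext_pellExp {a b : PellSolution} (h : ∀ u, pellExp a u = pellExp b u) :
    a = b := by
  have h' := fun u => h (-u)
  simp only [pellExp_neg_arg] at h'
  simp only [pellExp] at h
  exact PellSolution.ext
    (Entire.ext_cosh fun u => by linear_combination (h u + h' u) / 2)
    (Entire.ext_cosh_mul_sinh fun u => by linear_combination (h u - h' u) / 2)

theorem norm_cosh_le (u : ℂ) : ‖cosh u‖ ≤ Real.exp |u.re| := by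
  have h1 : ‖exp u‖ ≤ Real.exp |u.re| := by
    rw [norm_exp]; exact Real.exp_le_exp.2 (le_abs_self _)
  have h2 : ‖exp (-u)‖ ≤ Real.exp |u.re| := by
    rw [norm_exp]; exact Real.exp_le_exp.2 (neg_le_abs _)
  rw [cosh, norm_div, Complex.norm_ofNat, div_le_iff₀ two_pos]
  linarith [norm_add_le (exp u) (exp (-u))]

theorem norm_sinh_le (u : ℂ) : ‖sinh u‖ ≤ Real.exp |u.re| := by
  have h1 : ‖exp u‖ ≤ Real.exp |u.re| := by
    rw [norm_exp]; exact Real.exp_le_exp.2 (le_abs_self _)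
  have h2 : ‖exp (-u)‖ ≤ Real.exp |u.re| := by
    rw [norm_exp]; exact Real.exp_le_exp.2 (neg_le_abs _)
  rw [sinh, norm_div, Complex.norm_ofNat, div_le_iff₀ two_pos]
  linarith [norm_sub_le (exp u) (exp (-u))]

theorem exists_norm_pellExp_le {ρ σ : ℝ} (hσ : ρ < σ) (hσ0 : 0 < σ) {b : PellSolution}
    (hb : b.InBoundedOrder ρ) :
    ∃ B : ℝ, ∀ u, ‖pellExp b u‖ ≤ Real.exp (B * Real.exp (σ * |u.re|)) := by
  obtain ⟨C, hC, hx⟩ := exists_norm_le_exp_rpow hσ hσ0 hb.1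
  obtain ⟨D, hD, hy⟩ := exists_norm_le_exp_rpow hσ hσ0 hb.2
  -- `C` and `D` come from `x` and `y`, `1 / σ` absorbs the factor `sinh u`, and the last `1`
  -- absorbs a factor `2`.
  refine ⟨C + D + 1 / σ + 1, fun u => ?_⟩
  have hR : 1 ≤ Real.exp |u.re| := Real.one_le_exp (abs_nonneg _)
  have hpow : Real.exp |u.re| ^ σ = Real.exp (σ * |u.re|) := by rw [← Real.exp_mul, mul_comm]
  have h1 := hx _ _ hR (norm_cosh_le u)
  have h2 := hy _ _ hR (norm_cosh_le u)
  rw [hpow] at h1 h2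
  set E := Real.exp (σ * |u.re|) with hE
  have hE1 : 1 ≤ E := Real.one_le_exp (by positivity)
  have hu : |u.re| ≤ 1 / σ * E := by
    rw [div_mul_eq_mul_div, one_mul, le_div_iff₀ hσ0]
    linarith [Real.add_one_le_exp (σ * |u.re|)]
  have h3 : ‖pellExp b u‖ ≤ Real.exp (C * E) + Real.exp (D * E) * Real.exp |u.re| := by
    refine (norm_add_le _ _).trans (add_le_add h1 ?_)
    rw [norm_mul]
    exact mul_le_mul h2 (norm_sinh_le u) (norm_nonneg _) (Real.exp_pos _).le
  have h4 : Real.exp (C * E) ≤ Real.exp ((C + D + 1 / σ) * E) := by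
    gcongr
    have : 0 < 1 / σ := by positivity
    linarith
  have h5 : Real.exp (D * E) * Real.exp |u.re| ≤ Real.exp ((C + D + 1 / σ) * E) := by
    rw [← Real.exp_add]
    gcongr
    nlinarith
  have h6 : (2 : ℝ) ≤ Real.exp E := by linarith [Real.add_one_le_exp E]
  calc ‖pellExp b u‖ ≤ Real.exp ((C + D + 1 / σ) * E) * 2 := by linarith
    _ ≤ Real.exp ((C + D + 1 / σ) * E) * Real.exp E := by gcongr
    _ = _ := by rw [← Real.exp_add]; congr 1; ring

/-- The structure of the entire solutions of the Pell equation of order at most `ρ`. -/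
theorem exists_pellExp_eq {ρ : ℝ} (hρ : 0 ≤ ρ) {b : PellSolution} (hb : b.InBoundedOrder ρ) :
    ∃ (n : ℤ) (a : ℤ → ℂ), ∀ u, pellExp b u =
      exp (n * u + ∑ j ∈ Finset.Icc (-(⌊ρ⌋₊ : ℤ)) ⌊ρ⌋₊, a j * exp (j * u)) := by
  obtain ⟨σ, hσ, hσd⟩ := exists_between (Nat.lt_floor_add_one ρ)
  have hσ0 : 0 < σ := hρ.trans_lt hσ
  obtain ⟨B, hB⟩ := exists_norm_pellExp_le hσ hσ0 hb
  obtain ⟨n, h, hh, hper, hexp⟩ := exists_periodic_log (differentiable_pellExp b)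
    (pellExp_ne_zero b) (pellExp_periodic b)
  -- The growth bound at `u` gives the upper bound for `Re h`; at `-u`, where `E(-u) = 1 / E(u)`, it
  -- gives the lower one.
  have hbound : ∀ u : ℂ, |(h u).re| ≤ (B + |(n : ℝ)| / σ) * Real.exp (σ * |u.re|) := by
    intro u
    have h1 := hB u
    have h2 := hB (-u)
    have h3 : pellExp b (-u) = exp (-(n * u + h u)) := by
      rw [exp_neg, ← hexp]
      exact eq_inv_of_mul_eq_one_right (pellExp_mul_neg_arg b u)
    rw [h3, norm_exp, Real.exp_le_exp] at h2
    rw [hexp, norm_exp, Real.exp_le_exp] at h1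
    simp at h1 h2
    have h4 : |(n : ℝ) * u.re| ≤ |(n : ℝ)| / σ * Real.exp (σ * |u.re|) := by
      rw [abs_mul, div_mul_eq_mul_div, le_div_iff₀ hσ0, mul_assoc]
      gcongr
      linarith [Real.add_one_le_exp (σ * |u.re|)]
    rw [add_mul]
    have h5 := abs_le.1 h4
    exact abs_le.2 ⟨by linarith, by linarith⟩
  obtain ⟨a, ha⟩ := exists_laurent_of_re_le hh hper hσ0.le hbound hσd
  exact ⟨n, a, fun u => by rw [hexp, ha]⟩

/-! ### Polynomial solutions -/

/-- Evaluation at `z = cosh u`, `w = sinh u`. -/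
def evalCoshSinh (u : ℂ) : QuadraticAlgebra ℂ[X] (X ^ 2 - 1) 0 →+* ℂ where
  toFun s := s.re.eval (cosh u) + s.im.eval (cosh u) * sinh u
  map_one' := by simp [QuadraticAlgebra.re_one, QuadraticAlgebra.im_one]
  map_zero' := by simp
  map_add' s t := by simp; ring
  map_mul' s t := by
    simp
    linear_combination s.im.eval (cosh u) * t.im.eval (cosh u) * cosh_sq_sub_sinh_sq u

theorem eval_pellX_add_eval_pellY_mul_sinh (n : ℤ) (u : ℂ) :
    (pellX n).eval (cosh u) + (pellY n).eval (cosh u) * sinh u = exp (n * u) := by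
  have h1 : ((Units.map (evalCoshSinh u).toMonoidHom zAddW : ℂˣ) : ℂ) = exp u := by
    have : ((Units.map (evalCoshSinh u).toMonoidHom zAddW : ℂˣ) : ℂ) =
      (X : ℂ[X]).eval (cosh u) + (1 : ℂ[X]).eval (cosh u) * sinh u := rfl
    rw [this, eval_X, eval_one, one_mul, cosh_add_sinh]
  have h2 : (pellX n).eval (cosh u) + (pellY n).eval (cosh u) * sinh u =
      ((Units.map (evalCoshSinh u).toMonoidHom (zAddW ^ n) : ℂˣ) : ℂ) := rfl
  rw [h2, map_zpow, Units.val_zpow_eq_zpow_val, h1, exp_int_mul]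

theorem eval_pellX_sub_eval_pellY_mul_sinh (n : ℤ) (u : ℂ) :
    (pellX n).eval (cosh u) - (pellY n).eval (cosh u) * sinh u = exp (-(n * u)) := by
  have := eval_pellX_add_eval_pellY_mul_sinh n (-u)
  rw [cosh_neg, sinh_neg, mul_neg, mul_neg] at this
  rw [← this]; ring

theorem eval_pellY_mul_sinh (n : ℤ) (u : ℂ) :
    (pellY n).eval (cosh u) * sinh u = sinh (n * u) := by
  rw [sinh.eq_1 (n * u)]
  linear_combination (eval_pellX_add_eval_pellY_mul_sinh n u -
    eval_pellX_sub_eval_pellY_mul_sinh n u) / 2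

/-- The polynomial solution `(x_n, y_n)`. -/
def pellPoly (n : ℤ) : PellSolution where
  x := polyEntire (pellX n)
  y := polyEntire (pellY n)
  pell := by
    refine Entire.ext_cosh fun u => ?_
    change (pellX n).eval (cosh u) ^ 2 - ((X : ℂ[X]).eval (cosh u) ^ 2 - 1) *
      (pellY n).eval (cosh u) ^ 2 = 1
    have h : exp (n * u) * exp (-(n * u)) = 1 := by rw [← exp_add, add_neg_cancel, exp_zero]
    rw [← eval_pellX_add_eval_pellY_mul_sinh, ← eval_pellX_sub_eval_pellY_mul_sinh] at h
    rw [eval_X]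
    linear_combination h - (pellY n).eval (cosh u) ^ 2 * cosh_sq_sub_sinh_sq u

theorem pellPoly_inBoundedOrder (ρ : ℝ) (n : ℤ) : (pellPoly n).InBoundedOrder ρ :=
  ⟨polyEntire_mem_boundedOrder ρ _, polyEntire_mem_boundedOrder ρ _⟩

theorem pellExp_pellPoly (n : ℤ) (u : ℂ) : pellExp (pellPoly n) u = exp (n * u) :=
  eval_pellX_add_eval_pellY_mul_sinh n u

theorem nsmul_pellPoly (k : ℕ) (l : ℤ) : k • pellPoly l = pellPoly (k * l) :=
  PellSolution.ext_pellExp fun u => by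
    rw [pellExp_nsmul, pellExp_pellPoly, pellExp_pellPoly, ← exp_nat_mul]
    congr 1; push_cast; ring

theorem polyEntire_mul (P Q : ℂ[X]) : polyEntire (P * Q) = polyEntire P * polyEntire Q :=
  Subtype.ext (funext fun _ => eval_mul)

theorem polyEntire_injective : Function.Injective polyEntire := fun _ _ h =>
  Polynomial.funext fun z => congrFun (congrArg Subtype.val h) z

theorem pellY_neg (n : ℤ) : pellY (-n) = -pellY n := by
  refine polyEntire_injective (Entire.ext_cosh_mul_sinh fun u => ?_)
  change (pellY (-n)).eval (cosh u) * sinh u = (-pellY n).eval (cosh u) * sinh u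
  rw [eval_neg, neg_mul, eval_pellY_mul_sinh, eval_pellY_mul_sinh, ← sinh_neg]
  congr 1; push_cast; ring

theorem pellY_add (i j : ℤ) : pellY (i + j) = pellX i * pellY j + pellY i * pellX j := by
  simp only [pellY, pellX, zpow_add, Units.val_mul, QuadraticAlgebra.im_mul]
  ring

theorem pellY_dvd_pellY_mul (k l : ℤ) : pellY k ∣ pellY (k * l) := by
  have hnat : ∀ l : ℕ, pellY k ∣ pellY (k * l) := by
    intro l
    induction l with
    | zero => simp [pellY, QuadraticAlgebra.im_one]
    | succ l ih =>
      rw [Nat.cast_succ, mul_add, mul_one, pellY_add]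
      exact dvd_add (dvd_mul_left _ _) (ih.mul_right _)
  obtain ⟨l, rfl | rfl⟩ := l.eq_nat_or_neg
  · exact hnat l
  · rw [mul_neg, pellY_neg]
    exact (hnat l).neg_right

theorem pellY_dvdBoundedOrder (ρ : ℝ) (k l : ℤ) :
    DvdBoundedOrder ρ (polyEntire (pellY k)) (polyEntire (pellY (k * l))) := by
  obtain ⟨Q, hQ⟩ := pellY_dvd_pellY_mul k l
  exact ⟨polyEntire_mem_boundedOrder ρ _, polyEntire_mem_boundedOrder ρ _, polyEntire Q,
    polyEntire_mem_boundedOrder ρ _, by rw [hQ, polyEntire_mul]⟩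

/-! ### Consequences of divisibility by `y_k` -/

/-- Since `y_k(cosh u) sinh u = sinh (k u)`, the term `y w` vanishes at such `u`, and the Pell
equation leaves `x ^ 2 = 1`. -/
theorem pellExp_sq_eq_one_of_dvd {ρ : ℝ} {k : ℤ} {a : PellSolution}
    (h : DvdBoundedOrder ρ (polyEntire (pellY k)) a.y) {u : ℂ} (hu : sinh (k * u) = 0) :
    pellExp a u ^ 2 = 1 := by
  obtain ⟨-, -, g, -, hg⟩ := h
  have hy : a.y.1 (cosh u) = (pellY k).eval (cosh u) * g.1 (cosh u) := by rw [hg]; rfl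
  have h0 : a.y.1 (cosh u) * sinh u = 0 := by
    rw [hy, mul_right_comm, eval_pellY_mul_sinh, hu, zero_mul]
  have := a.pell_cosh u
  rw [pellExp, h0, add_zero]
  rw [h0] at this
  linear_combination this

theorem exists_y_eq_of_pellExp_eq {a : PellSolution} {ε : ℂ} (hε : ε ^ 2 = 1) {k n : ℤ}
    (h : ∀ u, pellExp a u = ε * exp ((k * n : ℤ) * u)) :
    ∃ n' : ℤ, a.y = polyEntire (pellY (k * n')) := by
  have hy : ∀ u, a.y.1 (cosh u) * sinh u = ε * sinh ((k * n : ℤ) * u) := fun u => by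
    have h1 := h u
    have h2 := h (-u)
    rw [pellExp_neg_arg, mul_neg] at h2
    rw [pellExp] at h1
    rw [sinh.eq_1 ((k * n : ℤ) * u)]
    linear_combination (h1 - h2) / 2
  rcases sq_eq_sq_iff_eq_or_eq_neg.1 (hε.trans (one_pow 2).symm) with rfl | rfl
  · refine ⟨n, Entire.ext_cosh_mul_sinh fun u => ?_⟩
    rw [hy, one_mul]
    exact (eval_pellY_mul_sinh _ u).symm
  · refine ⟨-n, Entire.ext_cosh_mul_sinh fun u => ?_⟩
    refine (hy u).trans (Eq.trans ?_ (eval_pellY_mul_sinh _ u).symm)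
    rw [neg_one_mul, ← sinh_neg]
    congr 1; push_cast; ring

theorem exists_y_eq_pellY {ρ : ℝ} (hρ : 0 ≤ ρ) {p q k : ℕ} (hp : p.Prime) (hq : q ≠ 0)
    (hpρ : 2 * ⌊ρ⌋₊ + 1 < p) (hk : k = p * q) {b : PellSolution} (hb : b.InBoundedOrder ρ)
    (hdvd : DvdBoundedOrder ρ (polyEntire (pellY k)) (k • b).y) :
    ∃ n : ℤ, (k • b).y = polyEntire (pellY (k * n)) := by
  obtain ⟨n, a, hexp⟩ := exists_pellExp_eq hρ hb
  set d := ⌊ρ⌋₊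
  have hp0 : (p : ℂ) ≠ 0 := Nat.cast_ne_zero.2 hp.ne_zero
  have hq0 : (q : ℂ) ≠ 0 := Nat.cast_ne_zero.2 hq
  have hk0 : (k : ℂ) ≠ 0 := by rw [hk]; push_cast; exact mul_ne_zero hp0 hq0
  have hpi : (2 * Real.pi * I : ℂ) ≠ 0 := two_pi_I_ne_zero
  have hζ := isPrimitiveRoot_exp p hp.ne_zero
  have hval : ∀ r : Fin p, ∃ c : ℤ, ∑ j ∈ Finset.Icc (-(d : ℤ)) d,
      a j * exp (2 * Real.pi * I / p) ^ (j * (r : ℤ)) = 2 * Real.pi * I / (2 * k) * c := by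
    intro r
    have hku : (k : ℂ) * (r * (2 * Real.pi * I / p)) = ((q * r : ℕ) : ℂ) * (2 * Real.pi * I) := by
      rw [hk]; push_cast; field_simp
    have hsinh : sinh (((k : ℤ) : ℂ) * (r * (2 * Real.pi * I / p))) = 0 := by
      have h1 : exp (((q * r : ℕ) : ℂ) * (2 * Real.pi * I)) = 1 := exp_nat_mul_two_pi_mul_I _
      rw [Int.cast_natCast, hku, sinh, exp_neg, h1]
      simp
    have hone := pellExp_sq_eq_one_of_dvd hdvd hsinh
    rw [pellExp_nsmul, hexp, ← pow_mul, ← exp_nat_mul] at hone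
    have hsum : ∑ j ∈ Finset.Icc (-(d : ℤ)) d,
        a j * exp (2 * Real.pi * I / p) ^ (j * (r : ℤ)) =
        ∑ j ∈ Finset.Icc (-(d : ℤ)) d, a j * exp (j * (r * (2 * Real.pi * I / p))) := by
      refine Finset.sum_congr rfl fun j _ => ?_
      rw [← exp_int_mul]
      congr 2; push_cast; ring
    obtain ⟨c, hc⟩ := exp_eq_one_iff.1 hone
    -- At `u = 2πi r / p` the linear term contributes `2 k n u = 2 n q r · 2πi`; the factor `2`
    -- comes from squaring `±1`.
    refine ⟨c - 2 * n * q * r, ?_⟩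
    rw [hsum, div_mul_eq_mul_div, eq_div_iff (mul_ne_zero two_ne_zero hk0)]
    push_cast at hc hku ⊢
    linear_combination hc - 2 * n * hku
  choose c hc using hval
  have hzero := fun i (hi : i ∈ Finset.Icc (-(d : ℤ)) d) (hi0 : i ≠ 0) =>
    hζ.laurent_coeff_eq_zero hp hpρ a (div_ne_zero hpi (mul_ne_zero two_ne_zero hk0)) c hc hi hi0
  have hconst : ∀ u, pellExp b u = exp (a 0) * exp (n * u) := fun u => by
    rw [hexp, Finset.sum_eq_single_of_mem 0 (by simp) fun j hj hj0 => by
      rw [hzero j hj hj0, zero_mul], exp_add, mul_comm]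
    simp
  -- This is `E(u) E(-u) = 1` at `u = 0`.
  have hε : exp (a 0) ^ 2 = 1 := by
    have h1 := pellExp_mul_neg_arg b 0
    rw [neg_zero, hconst] at h1
    simpa [sq] using h1
  refine exists_y_eq_of_pellExp_eq (ε := exp (a 0) ^ k) (n := n) ?_ fun u => ?_
  · rw [← pow_mul, mul_comm, pow_mul, hε, one_pow]
  · rw [pellExp_nsmul, hconst, mul_pow, ← exp_nat_mul _ k, ← exp_nat_mul _ k]
    congr 2; push_cast; ring

end Pell

end

theorem lemma5p1 (ρ : ℝ) (hρ : 0 ≤ ρ) (m p q k : ℕ) (hm : m = 2 * (⌊ρ⌋₊ + 1))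
    (hp : p.Prime) (hq : q.Prime) (hpm : m + 1 < p) (hqm : 2 * (m + 1) < q)
    (hk : k = p * q) :
    (∀ a : PellSolution, a.InBoundedOrder ρ →
      (∃ b : PellSolution, b.InBoundedOrder ρ ∧ k • b = a) →
      DvdBoundedOrder ρ (polyEntire (pellY k)) a.y →
      ∃ n : ℤ, a.y = polyEntire (pellY (k * n))) ∧
    (∀ l : ℤ, ∃ a : PellSolution,
      a.x = polyEntire (pellX (k * l)) ∧ a.y = polyEntire (pellY (k * l)) ∧
      a.InBoundedOrder ρ ∧
      (∃ b : PellSolution, b.InBoundedOrder ρ ∧ k • b = a) ∧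
      DvdBoundedOrder ρ (polyEntire (pellY k)) a.y) := by
  refine ⟨?_, fun l => ⟨pellPoly (k * l), rfl, rfl, pellPoly_inBoundedOrder ρ _,
    ⟨pellPoly l, pellPoly_inBoundedOrder ρ l, nsmul_pellPoly k l⟩, pellY_dvdBoundedOrder ρ k l⟩⟩
  rintro _ - ⟨b, hb, rfl⟩ hdvd
  exact exists_y_eq_pellY hρ hp hq.ne_zero (by omega) hk hb hdvd
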